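/- For a finite digraph $D$ let $d_D(u,v)$ be the length of a shortest directed path from $u$ to $v$, with $d_D(u,v)=0$ if there is no such path, and let the Wiener index of $D$ be $W(D)=\sum_{(u,v)\in V(D)\times V(D)} d_D(u,v)$. Let $G_{m,n}$ be the $m\times n$ grid, that is, the Cartesian product of paths on $m$ and $n$ vertices, with vertices $(i,j)$, $1\le i\le m$ (rows, numbered from top to bottom), $1\le j\le n$ (columns, numbered from left to right). For even $n$, let $C_{m,n}$ be the comb orientation of $G_{m,n}$, defined as follows. Let $P$ be the Hamiltonian path of $G_{m,n}$ that starts at $(1,1)$, runs through the top row from left to right to $(1,n)$, and then passes through the vertices in rows $2,\dots,m$ column by column, for $j=n,n-1,\dots,1$, going down (from row $2$ to row $m$) in column $j$ if $j$ is even and up (from row $m$ to row $2$) if $j$ is odd, so that it ends at $(2,1)$. In $C_{m,n}$ the edges of $P$ are directed along $P$, and every other edge of the grid is directed from its end that comes later on $P$ to its end that comes earlier on $P$; in particular, $P$ together with the arc from $(2,1)$ to $(1,1)$ is a directed Hamiltonian cycle. If $m$ and $n$ are both even and $4\le m<n$, then $$W(C_{m,n})>W(C_{n,m}).$$ -/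

import Mathlib

namespace DirectedGrid

/-- There is a directed path `v₀, v₁, …, v_t` of length `t` from `u` to `v` in the digraph `D`:
a sequence of vertices in which every `v_{i} v_{i+1}` is an arc. -/
def HasPathOfLength {V : Type*} (D : Digraph V) (u v : V) (t : ℕ) : Prop :=
  ∃ p : ℕ → V, p 0 = u ∧ p t = v ∧ ∀ i < t, D.Adj (p i) (p (i + 1))

/-- The distance from `u` to `v`: the length of a shortest directed path from `u` to `v`, and `0`
if there is no such path (the infimum of the empty set of natural numbers is `0`). -/
noncomputable def dist {V : Type*} (D : Digraph V) (u v : V) : ℕ :=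
  sInf {t : ℕ | HasPathOfLength D u v t}

/-- The Wiener index of a finite digraph: the sum of the distances over all ordered pairs. -/
noncomputable def wienerIndex {V : Type*} [Fintype V] (D : Digraph V) : ℕ :=
  ∑ u : V, ∑ v : V, dist D u v

/-- The grid with `m` rows and `n` columns, the Cartesian product of paths on `m` and `n` vertices.
The vertex `(i, j)` is in row `i` (row `0` is the top row) and column `j` (column `0` is the
leftmost one). -/
def grid (m n : ℕ) : SimpleGraph (Fin m × Fin n) :=
  (SimpleGraph.pathGraph m).boxProd (SimpleGraph.pathGraph n)

/-- The position (starting from `0`) of the vertex `(i, j)` on the comb-like Hamiltonian path that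
starts in the top left vertex. The path runs through the top row (`i = 0`) from left to right, and
then through the remaining `m - 1` vertices of each column, taking the columns from right to left:
down the last column, up the one before it, and so on, alternately. For `n` even this is a
Hamiltonian path of the grid (in zero-based numbering, it goes down the columns with `j` odd and
up those with `j` even), it ends in the vertex below the top left one, and together with the edge
from there to the top left vertex it is a Hamiltonian cycle. -/
def combPos (m n : ℕ) (x : Fin m × Fin n) : ℕ :=
  if (x.1 : ℕ) = 0 then (x.2 : ℕ)
  else n + (n - 1 - (x.2 : ℕ)) * (m - 1) +
    (if (x.2 : ℕ) % 2 = 1 then (x.1 : ℕ) - 1 else m - 1 - (x.1 : ℕ))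

/-- The comb orientation of the grid with `m` rows and `n` columns (meant for `n` even): an edge
that joins two consecutive vertices of the comb-like Hamiltonian path is directed along the path,
and every other edge is directed backwards, from its later to its earlier vertex on the path.
(The edge that closes the path to a Hamiltonian cycle is one of the latter.) -/
def comb (m n : ℕ) : Digraph (Fin m × Fin n) where
  Adj x y := (grid m n).Adj x y ∧
    (combPos m n y = combPos m n x + 1 ∨ combPos m n y + 1 < combPos m n x)

end DirectedGrid

/-! Rows and columns count from 0, and P is the comb path. All distances are written down explicitly
in `combDist`. No arc advances by more than one position on P. From the top row, or towards a column
further left, nothing beats following P: the distance is a difference of positions, plus one step up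
when the target lies in the top row to the left of the source. Inside a column, moving against its
direction costs a detour through a neighbouring column. Towards the right the distance is the grid
distance, plus 2 for a target in the same row if that row is blocked.

The formula is verified as a potential: it vanishes at the source, grows by at most 1 along each arc
(`CombArc.combDist_le`), and every other vertex has an in-neighbour with value one smaller
(`exists_combPred`). This gives `dist_comb`. Summing over pairs of columns yields the polynomial
`wienerIndex_comb`. Swapping m and n and subtracting leaves the leading part m²n²(n - m)/6, which
dominates the remaining terms when 4 ≤ m < n. -/

namespace DirectedGrid

/-! ### Arcs in coordinates and the distance formula -/

/-- The arcs of the comb orientation in terms of the coordinates of their ends. -/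
def CombArc (m n a b a' b' : ℕ) : Prop :=
  (a' = a ∧ b' = b + 1 ∧ (a = 0 ∨ (b % 2 = 0 ∧ a + 2 ≤ m) ∨ (b % 2 = 1 ∧ 2 ≤ a))) ∨
  (a' = a ∧ b = b' + 1 ∧ ((b % 2 = 1 ∧ a + 1 = m) ∨ (b % 2 = 0 ∧ a = 1))) ∨
  (b' = b ∧ a' = a + 1 ∧ ((1 ≤ a ∧ b % 2 = 1) ∨ (a = 0 ∧ b + 1 = n))) ∨
  (b' = b ∧ a = a' + 1 ∧ ((1 ≤ a' ∧ b % 2 = 0) ∨ (a' = 0 ∧ b + 1 ≠ n)))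

/-- The number of vertices below the top row in the columns to the right of column `b`. -/
def colOffset (m n b : ℕ) : ℤ := ((n : ℤ) - 1 - b) * ((m : ℤ) - 1)

/-- The product in `colOffset` is nonlinear, so `omega` treats it as an atom; this and the next
lemmas are the linear facts it needs. -/
lemma colOffset_succ (m n b : ℕ) : colOffset m n b = colOffset m n (b + 1) + ((m : ℤ) - 1) := by
  unfold colOffset; push_cast; ring

lemma colOffset_last {m n b : ℕ} (h : b + 1 = n) : colOffset m n b = 0 := by
  subst h; unfold colOffset; push_cast; ring

lemma colOffset_nonneg {m n b : ℕ} (hm : 1 ≤ m) (h : b < n) : 0 ≤ colOffset m n b := by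
  unfold colOffset
  exact mul_nonneg (by omega) (by omega)

lemma colOffset_lt {m n b j : ℕ} (hm : 1 ≤ m) (h : b < j) :
    colOffset m n j + ((m : ℤ) - 1) ≤ colOffset m n b := by
  have h1 : 0 ≤ ((j : ℤ) - b - 1) * ((m : ℤ) - 1) := mul_nonneg (by omega) (by omega)
  unfold colOffset
  linarith [h1]

/-- The position on the comb-like path of a vertex `(a, b)` below the top row. -/
def lowPos (m n a b : ℕ) : ℤ :=
  n + colOffset m n b + if b % 2 = 1 then (a : ℤ) - 1 else (m : ℤ) - 1 - a

/-- The distance from `(i, j)` to `(a, b)` in the comb orientation. -/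
def combDist (m n i j a b : ℕ) : ℤ :=
  if i = 0 then
    if a = 0 then
      if j ≤ b then (b : ℤ) - j else lowPos m n 1 b + 1 - j
    else lowPos m n a b - j
  else if b < j then
    if a = 0 then lowPos m n 1 b + 1 - lowPos m n i j
    else lowPos m n a b - lowPos m n i j
  else if b = j then
    if a = 0 then
      if j % 2 = 0 then (i : ℤ)
      -- Down to the bottom, left, up to the top row, right.
      else if j + 1 = n then 2 * m - i
      else if i = 1 then 1 else i + 2
    else if j % 2 = 1 then
      if i ≤ a then (a : ℤ) - i
      else if j + 1 = n then 2 * m - i - a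
      -- For odd j, i + a is the detour right, up to row 1, back left and down; 2m - i - a is the
      -- one by the bottom row and the left column. For even j the two sides are exchanged.
      else if i + a ≤ m then (i : ℤ) + a else 2 * m - i - a
    else
      if a ≤ i then (i : ℤ) - a
      else if j = 0 then 2 * m - i - a
      else if i + a ≤ m then (i : ℤ) + a else 2 * m - i - a
  else if a < i then (b : ℤ) - j + (i - a)
  else if i < a then (b : ℤ) - j + (a - i)
  -- The bottom row cannot be followed rightwards out of an even column, nor row 1 out of an odd
  -- one; evading it for the whole trip costs 2.
  else (b : ℤ) - j + (if i + 1 = m ∧ (j % 2 = 0 ∨ j + 2 ≤ b) then 2 else 0)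
    + (if i = 1 ∧ (j % 2 = 1 ∨ j + 2 ≤ b) then 2 else 0)

lemma combPos_zero {m n : ℕ} (x : Fin m × Fin n) (h : (x.1 : ℕ) = 0) :
    (combPos m n x : ℤ) = x.2 := by
  simp [combPos, h]

lemma combPos_pos {m n : ℕ} (x : Fin m × Fin n) (h : (x.1 : ℕ) ≠ 0) :
    (combPos m n x : ℤ) = lowPos m n x.1 x.2 := by
  have h1 := x.1.2
  have h2 := x.2.2
  simp only [combPos, h, if_false, lowPos, colOffset]
  push_cast [Nat.cast_sub (show (x.2 : ℕ) ≤ n - 1 by omega), Nat.cast_sub (show 1 ≤ n by omega),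
    Nat.cast_sub (show 1 ≤ m by omega), Nat.cast_sub (show (x.1 : ℕ) ≤ m - 1 by omega),
    Nat.cast_sub (show 1 ≤ (x.1 : ℕ) by omega)]
  rfl

lemma grid_adj {m n : ℕ} (x y : Fin m × Fin n) : (grid m n).Adj x y ↔
    ((x.1 : ℕ) = y.1 ∧ ((x.2 : ℕ) + 1 = y.2 ∨ (y.2 : ℕ) + 1 = x.2)) ∨
    ((x.2 : ℕ) = y.2 ∧ ((x.1 : ℕ) + 1 = y.1 ∨ (y.1 : ℕ) + 1 = x.1)) := by
  simp only [grid, SimpleGraph.boxProd_adj, SimpleGraph.pathGraph_adj, Fin.ext_iff]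
  tauto

lemma comb_adj_iff {m n : ℕ} (hm : 4 ≤ m) (hn : Even n) (x y : Fin m × Fin n) :
    (comb m n).Adj x y ↔ CombArc m n x.1 x.2 y.1 y.2 := by
  have hp : ((comb m n).Adj x y ↔ (grid m n).Adj x y ∧
    ((combPos m n y : ℤ) = combPos m n x + 1 ∨ (combPos m n y : ℤ) + 1 < combPos m n x)) := by
    simp only [comb]; norm_cast
  rw [hp, grid_adj]
  have hx := combPos_zero x
  have hx' := combPos_pos x
  have hy := combPos_zero y
  have hy' := combPos_pos y
  have k1 := x.1.2
  have k2 := x.2.2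
  have k3 := y.1.2
  have k4 := y.2.2
  generalize (combPos m n x : ℤ) = px at *
  generalize (combPos m n y : ℤ) = py at *
  generalize (x.1 : ℕ) = a at *
  generalize (x.2 : ℕ) = b at *
  generalize (y.1 : ℕ) = a' at *
  generalize (y.2 : ℕ) = b' at *
  unfold CombArc
  have hn2 : n % 2 = 0 := Nat.even_iff.mp hn
  have o1 := colOffset_succ m n b
  have o2 := colOffset_succ m n b'
  have o3 := @colOffset_last m n b
  have o4 := @colOffset_nonneg m n b (by omega) k2
  have o5 := @colOffset_nonneg m n b' (by omega) k4
  have o6 : b + 1 < n → 0 ≤ colOffset m n (b+1) := colOffset_nonneg (by omega)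
  unfold lowPos at hx' hy'
  clear hp
  constructor
  · rintro ⟨⟨rfl, rfl | rfl⟩ | ⟨rfl, rfl | rfl⟩, h⟩
    · refine Or.inl ⟨rfl, rfl, ?_⟩
      split_ifs at hx' hy' <;> omega
    · refine Or.inr (Or.inl ⟨rfl, rfl, ?_⟩)
      split_ifs at hx' hy' <;> omega
    · refine Or.inr (Or.inr (Or.inl ⟨rfl, rfl, ?_⟩))
      split_ifs at hx' hy' <;> omega
    · refine Or.inr (Or.inr (Or.inr ⟨rfl, rfl, ?_⟩))
      split_ifs at hx' hy' <;> omega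
  · rintro (⟨rfl, rfl, h⟩ | ⟨rfl, rfl, h⟩ | ⟨rfl, rfl, h⟩ | ⟨rfl, rfl, h⟩)
    · refine ⟨by omega, ?_⟩
      split_ifs at hx' hy' <;> omega
    · refine ⟨by omega, ?_⟩
      split_ifs at hx' hy' <;> omega
    · refine ⟨by omega, ?_⟩
      split_ifs at hx' hy' <;> omega
    · refine ⟨by omega, ?_⟩
      split_ifs at hx' hy' <;> omega

/-! ### The formula grows by at most one along an arc -/

set_option maxHeartbeats 2000000 in
lemma combDist_right {m n i j a b : ℕ} (hm : 4 ≤ m) (hn : n % 2 = 0) (hi : i < m) (hj : j < n)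
    (ha : a < m) (hb : b + 1 < n)
    (h : (a = 0 ∨ (b % 2 = 0 ∧ a + 2 ≤ m) ∨ (b % 2 = 1 ∧ 2 ≤ a))) :
    combDist m n i j a (b + 1) ≤ combDist m n i j a b + 1 := by
  have o1 := colOffset_succ m n b
  have o3 := @colOffset_last m n b
  have o4 := @colOffset_nonneg m n (b + 1) (by omega) hb
  rcases Nat.eq_zero_or_pos i with rfl | h0
  · simp only [combDist, lowPos, if_true]
    split_ifs <;> first | contradiction | omega
  -- The formula changes shape at the source column, so arcs entering and leaving that column need
  -- their own cases.
  rcases lt_trichotomy (b + 1) j with h1 | rfl | h1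
  · simp only [combDist, lowPos, h1, (show b < j by omega), h0.ne', if_true, if_false]
    split_ifs <;> first | contradiction | omega
  · simp only [combDist, lowPos, h0.ne', lt_irrefl, (show b < b + 1 by omega), if_true, if_false]
    split_ifs <;> first | contradiction | omega
  · rcases (show b = j ∨ j < b by omega) with rfl | h2
    · simp only [combDist, h0.ne', lt_irrefl, (show ¬ b + 1 < b by omega),
        (show ¬ b + 1 = b by omega), if_true, if_false]
      split_ifs <;> first | contradiction | omega
    · simp only [combDist, h0.ne', h1.ne', h2.ne', h1.not_gt, h2.not_gt, if_false]
      split_ifs <;> first | contradiction | omega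

set_option maxHeartbeats 2000000 in
lemma combDist_left {m n i j a b : ℕ} (hm : 4 ≤ m) (hn : n % 2 = 0) (hi : i < m) (hj : j < n)
    (hb : b + 1 < n)
    (h : ((b % 2 = 0 ∧ a + 1 = m) ∨ (b % 2 = 1 ∧ a = 1))) :
    combDist m n i j a b ≤ combDist m n i j a (b + 1) + 1 := by
  have o1 := colOffset_succ m n b
  have o3 := @colOffset_last m n b
  have o4 := @colOffset_nonneg m n (b + 1) (by omega) hb
  rcases Nat.eq_zero_or_pos i with rfl | h0
  · simp only [combDist, lowPos, if_true]
    split_ifs <;> first | contradiction | omega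
  rcases lt_trichotomy (b + 1) j with h1 | rfl | h1
  · simp only [combDist, lowPos, h1, (show b < j by omega), h0.ne', if_true, if_false]
    split_ifs <;> first | contradiction | omega
  · simp only [combDist, lowPos, h0.ne', lt_irrefl, (show b < b + 1 by omega), if_true, if_false]
    split_ifs <;> first | contradiction | omega
  · rcases (show b = j ∨ j < b by omega) with rfl | h2
    · simp only [combDist, h0.ne', lt_irrefl, (show ¬ b + 1 < b by omega),
        (show ¬ b + 1 = b by omega), if_true, if_false]
      split_ifs <;> first | contradiction | omega
    · simp only [combDist, h0.ne', h1.ne', h2.ne', h1.not_gt, h2.not_gt, if_false]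
      split_ifs <;> first | contradiction | omega

set_option maxHeartbeats 2000000 in
lemma combDist_down {m n i j a b : ℕ} (hm : 4 ≤ m) (hn : n % 2 = 0) (hi : i < m) (hj : j < n)
    (ha : a + 1 < m) (hb : b < n)
    (h : ((1 ≤ a ∧ b % 2 = 1) ∨ (a = 0 ∧ b + 1 = n))) :
    combDist m n i j (a + 1) b ≤ combDist m n i j a b + 1 := by
  have o1 := colOffset_succ m n b
  have o3 := @colOffset_last m n b
  have o4 := @colOffset_nonneg m n b (by omega) hb
  rcases Nat.eq_zero_or_pos i with rfl | h0
  · simp only [combDist, lowPos, if_true]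
    split_ifs <;> first | contradiction | omega
  rcases lt_trichotomy b j with h1 | rfl | h1
  · simp only [combDist, lowPos, h1, h0.ne', if_true, if_false]
    split_ifs <;> first | contradiction | omega
  · simp only [combDist, h0.ne', lt_irrefl, if_true, if_false]
    split_ifs <;> first | contradiction | omega
  · simp only [combDist, h0.ne', h1.ne', h1.not_gt, if_false]
    split_ifs <;> first | contradiction | omega

set_option maxHeartbeats 2000000 in
lemma combDist_up {m n i j a b : ℕ} (hm : 4 ≤ m) (hn : n % 2 = 0) (hi : i < m) (hj : j < n)
    (ha : a + 1 < m) (hb : b < n)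
    (h : ((1 ≤ a ∧ b % 2 = 0) ∨ (a = 0 ∧ b + 1 ≠ n))) :
    combDist m n i j a b ≤ combDist m n i j (a + 1) b + 1 := by
  have o1 := colOffset_succ m n b
  have o3 := @colOffset_last m n b
  have o4 := @colOffset_nonneg m n b (by omega) hb
  rcases Nat.eq_zero_or_pos i with rfl | h0
  · simp only [combDist, lowPos, if_true]
    split_ifs <;> first | contradiction | omega
  rcases lt_trichotomy b j with h1 | rfl | h1
  · simp only [combDist, lowPos, h1, h0.ne', if_true, if_false]
    split_ifs <;> first | contradiction | omega
  · simp only [combDist, h0.ne', lt_irrefl, if_true, if_false]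
    split_ifs <;> first | contradiction | omega
  · simp only [combDist, h0.ne', h1.ne', h1.not_gt, if_false]
    split_ifs <;> first | contradiction | omega

lemma combDist_self (m n i j : ℕ) :
    combDist m n i j i j = 0 := by
  simp only [combDist, lt_irrefl]
  split_ifs <;> first | contradiction | omega

lemma combDist_nonneg {m n i j a b : ℕ} (hm : 4 ≤ m) (hi : i < m) (hj : j < n)
    (ha : a < m) (hb : b < n) : 0 ≤ combDist m n i j a b := by
  have o1 := @colOffset_lt m n b j (by omega)
  have o2 := @colOffset_nonneg m n b (by omega) hb
  simp only [combDist, lowPos]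
  split_ifs <;> first | contradiction | omega

/-! ### Predecessors one step closer to the source -/

/-- `(x, y)` is a vertex with an arc to `(a, b)` that is one step closer to `(i, j)`. -/
def CombPred (m n i j a b x y : ℕ) : Prop :=
  x < m ∧ y < n ∧ CombArc m n x y a b ∧ combDist m n i j x y + 1 = combDist m n i j a b

lemma CombPred.right {m n i j a b : ℕ} (ha : a < m) (hb : b + 1 < n)
    (h : a = 0 ∨ (b % 2 = 0 ∧ a + 2 ≤ m) ∨ (b % 2 = 1 ∧ 2 ≤ a))
    (hd : combDist m n i j a b + 1 = combDist m n i j a (b + 1)) :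
    CombPred m n i j a (b + 1) a b :=
  ⟨ha, by omega, Or.inl ⟨rfl, rfl, h⟩, hd⟩

lemma CombPred.left {m n i j a b : ℕ} (ha : a < m) (hb : b + 1 < n)
    (h : (b % 2 = 0 ∧ a + 1 = m) ∨ (b % 2 = 1 ∧ a = 1))
    (hd : combDist m n i j a (b + 1) + 1 = combDist m n i j a b) :
    CombPred m n i j a b a (b + 1) :=
  ⟨ha, by omega, Or.inr (Or.inl ⟨rfl, rfl, by omega⟩), hd⟩

lemma CombPred.down {m n i j a b : ℕ} (ha : a + 1 < m) (hb : b < n)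
    (h : (1 ≤ a ∧ b % 2 = 1) ∨ (a = 0 ∧ b + 1 = n))
    (hd : combDist m n i j a b + 1 = combDist m n i j (a + 1) b) :
    CombPred m n i j (a + 1) b a b :=
  ⟨by omega, hb, Or.inr (Or.inr (Or.inl ⟨rfl, rfl, h⟩)), hd⟩

lemma CombPred.up {m n i j a b : ℕ} (ha : a + 1 < m) (hb : b < n)
    (h : (1 ≤ a ∧ b % 2 = 0) ∨ (a = 0 ∧ b + 1 ≠ n))
    (hd : combDist m n i j (a + 1) b + 1 = combDist m n i j a b) :
    CombPred m n i j a b (a + 1) b :=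
  ⟨ha, hb, Or.inr (Or.inr (Or.inr ⟨rfl, rfl, h⟩)), hd⟩

/-- The predecessor on P works, except for targets in the top row left of the source, which are
entered from below. -/
lemma exists_combPred_of_zero {m n j a b : ℕ} (hm : 4 ≤ m) (hn : n % 2 = 0) (hj : j < n)
    (ha : a < m) (hb : b < n) (hne : ¬ (a = 0 ∧ b = j)) :
    ∃ x y, CombPred m n 0 j a b x y := by
  have o1 := colOffset_succ m n b
  have o3 := @colOffset_last m n b
  rcases Nat.eq_zero_or_pos a with rfl | h0
  · by_cases hjb : j < b
    · obtain ⟨c, rfl⟩ : ∃ c, b = c + 1 := ⟨b - 1, by omega⟩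
      refine ⟨_, _, .right (by omega) hb (by omega) ?_⟩
      simp only [combDist, lowPos, if_true]
      split_ifs <;> first | contradiction | omega
    · refine ⟨_, _, .up (by omega) hb (by omega) ?_⟩
      simp only [combDist, lowPos, if_true]
      split_ifs <;> first | contradiction | omega
  obtain ⟨c, rfl⟩ : ∃ c, a = c + 1 := ⟨a - 1, by omega⟩
  by_cases hb2 : b % 2 = 1
  · by_cases hl : 1 ≤ c ∨ b + 1 = n
    · refine ⟨_, _, .down ha hb (by omega) ?_⟩
      simp only [combDist, lowPos, if_true]
      split_ifs <;> first | contradiction | omega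
    · refine ⟨_, _, .left ha (by omega) (by omega) ?_⟩
      simp only [combDist, lowPos, if_true]
      split_ifs <;> first | contradiction | omega
  · by_cases hl : c + 2 < m
    · refine ⟨_, _, .up hl hb (by omega) ?_⟩
      simp only [combDist, lowPos, if_true]
      split_ifs <;> first | contradiction | omega
    · refine ⟨_, _, .left ha (by omega) (by omega) ?_⟩
      simp only [combDist, lowPos, if_true]
      split_ifs <;> first | contradiction | omega

set_option maxHeartbeats 1000000 in
lemma exists_combPred_of_lt {m n i j a b : ℕ} (hm : 4 ≤ m) (hi0 : i ≠ 0)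
    (hi : i < m) (hj : j < n) (ha : a < m) (hlt : b < j) :
    ∃ x y, CombPred m n i j a b x y := by
  have o1 := colOffset_succ m n b
  rcases Nat.eq_zero_or_pos a with rfl | h0
  · refine ⟨_, _, .up (by omega) (by omega) (by omega) ?_⟩
    simp only [combDist, lowPos, hi0, hlt, if_true, if_false]
    split_ifs <;> first | contradiction | omega
  obtain ⟨c, rfl⟩ : ∃ c, a = c + 1 := ⟨a - 1, by omega⟩
  by_cases hb2 : b % 2 = 1
  · by_cases hl : 1 ≤ c
    · refine ⟨_, _, .down ha (by omega) (by omega) ?_⟩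
      simp only [combDist, lowPos, hi0, hlt, if_true, if_false]
      split_ifs <;> first | contradiction | omega
    · refine ⟨_, _, .left ha (by omega) (by omega) ?_⟩
      rcases (show b + 1 = j ∨ b + 1 < j by omega) with rfl | h1
      · simp only [combDist, lowPos, hi0, hlt, lt_irrefl, if_true, if_false]
        split_ifs <;> first | contradiction | omega
      · simp only [combDist, lowPos, hi0, hlt, h1, if_true, if_false]
        split_ifs <;> first | contradiction | omega
  · by_cases hl : c + 2 < m
    · refine ⟨_, _, .up hl (by omega) (by omega) ?_⟩
      simp only [combDist, lowPos, hi0, hlt, if_true, if_false]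
      split_ifs <;> first | contradiction | omega
    · refine ⟨_, _, .left ha (by omega) (by omega) ?_⟩
      rcases (show b + 1 = j ∨ b + 1 < j by omega) with rfl | h1
      · simp only [combDist, lowPos, hi0, hlt, lt_irrefl, if_true, if_false]
        split_ifs <;> first | contradiction | omega
      · simp only [combDist, lowPos, hi0, hlt, h1, if_true, if_false]
        split_ifs <;> first | contradiction | omega

-- The last step of a detour depends on its side: through the left column it ends with a step right
-- (`hl`); through the right column it re-enters at row 1 or at the bottom row and then follows
-- column j.
set_option maxHeartbeats 1000000 in
lemma exists_combPred_of_eq {m n i j a : ℕ} (hm : 4 ≤ m) (hn : n % 2 = 0) (hi0 : i ≠ 0)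
    (hi : i < m) (hj : j < n) (ha : a < m) (hne : a ≠ i) :
    ∃ x y, CombPred m n i j a j x y := by
  have hcol : ∀ x, combDist m n i j x j = _ := fun x => by
    simp only [combDist, hi0, lt_irrefl, if_true, if_false]; rfl
  have hleft : ∀ c, j = c + 1 → ∀ x, combDist m n i j x c = _ := fun c hc x => by
    simp only [combDist, hi0, show c < j by omega, if_true, if_false]; rfl
  have hright : ∀ x, combDist m n i j x (j + 1) = _ := fun x => by
    simp only [combDist, hi0, show ¬ j + 1 < j by omega, show j + 1 ≠ j by omega, if_false]; rfl
  by_cases hfwd : (j % 2 = 1 ∧ i < a) ∨ (j % 2 = 0 ∧ a < i) ∨ (a = 0 ∧ j + 1 ≠ n)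
  · rcases hfwd with h | h
    · obtain ⟨c, rfl⟩ : ∃ c, a = c + 1 := ⟨a - 1, by omega⟩
      refine ⟨_, _, .down ha hj (by omega) ?_⟩
      rw [hcol, hcol]
      split_ifs <;> first | contradiction | omega
    · refine ⟨_, _, .up (by omega) hj (by omega) ?_⟩
      rw [hcol, hcol]
      split_ifs <;> first | contradiction | omega
  by_cases hl : (j % 2 = 1 ∧ (j + 1 = n ∨ m < i + a)) ∨ (j % 2 = 0 ∧ j ≠ 0 ∧ i + a ≤ m)
  · obtain ⟨c, rfl⟩ : ∃ c, j = c + 1 := ⟨j - 1, by omega⟩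
    have o1 := colOffset_succ m n c
    refine ⟨_, _, .right ha hj (by omega) ?_⟩
    rw [hcol, hleft c rfl]
    simp only [lowPos]
    split_ifs <;> first | contradiction | omega
  by_cases hj2 : j % 2 = 1
  · by_cases h1 : a = 1
    · subst h1
      refine ⟨_, _, .left ha (by omega) (by omega) ?_⟩
      rw [hcol, hright]
      split_ifs <;> first | contradiction | omega
    · obtain ⟨c, rfl⟩ : ∃ c, a = c + 1 := ⟨a - 1, by omega⟩
      refine ⟨_, _, .down ha hj (by omega) ?_⟩
      rw [hcol, hcol]
      split_ifs <;> first | contradiction | omega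
  · by_cases h1 : a + 1 = m
    · refine ⟨_, _, .left ha (by omega) (by omega) ?_⟩
      rw [hcol, hright]
      split_ifs <;> first | contradiction | omega
    · refine ⟨_, _, .up (by omega) hj (by omega) ?_⟩
      rw [hcol, hcol]
      split_ifs <;> first | contradiction | omega

set_option maxHeartbeats 1000000 in
lemma exists_combPred_of_gt {m n i j a b : ℕ} (hm : 4 ≤ m) (hn : n % 2 = 0) (hi0 : i ≠ 0)
    (hi : i < m) (ha : a < m) (hb : b + 1 < n) (hlt : j < b + 1) :
    ∃ x y, CombPred m n i j a (b + 1) x y := by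
  have hcol : ∀ x, combDist m n i j x (b + 1) = _ := fun x => by
    simp only [combDist, hi0, hlt.not_gt, hlt.ne', if_false]; rfl
  have hleft : ∀ x, combDist m n i j x b = _ := fun x => by
    simp only [combDist, hi0, show ¬ b < j by omega, if_false]; rfl
  have right : ∀ (_ : a = 0 ∨ (b % 2 = 0 ∧ a + 2 ≤ m) ∨ (b % 2 = 1 ∧ 2 ≤ a))
    (_ : combDist m n i j a b + 1 = combDist m n i j a (b + 1)),
      ∃ x y, CombPred m n i j a (b + 1) x y := fun h h' => ⟨_, _, .right ha hb h h'⟩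
  have up : ∀ (_ : a + 1 < m) (_ : (1 ≤ a ∧ (b + 1) % 2 = 0) ∨ (a = 0 ∧ b + 1 + 1 ≠ n))
    (_ : combDist m n i j (a + 1) (b + 1) + 1 = combDist m n i j a (b + 1)),
      ∃ x y, CombPred m n i j a (b + 1) x y := fun h0 h h' => ⟨_, _, .up h0 hb h h'⟩
  have down : ∀ c, a = c + 1 → ∀ (_ : (1 ≤ c ∧ (b + 1) % 2 = 1) ∨ (c = 0 ∧ b + 1 + 1 = n))
    (_ : combDist m n i j c (b + 1) + 1 = combDist m n i j a (b + 1)),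
      ∃ x y, CombPred m n i j a (b + 1) x y := by
    rintro c rfl h h'
    exact ⟨_, _, .down ha hb h h'⟩
  by_cases h0 : a = 0
  · by_cases h1 : i = 1 ∨ b ≠ j ∨ j % 2 = 0
    · refine right (by omega) ?_
      rw [hcol, hleft]
      split_ifs <;> first | contradiction | omega
    · refine up (by omega) (by omega) ?_
      rw [hcol, hcol]
      split_ifs <;> first | contradiction | omega
  rcases lt_trichotomy a i with h | h | h
  -- If a + 2 = m, the source is in the bottom row. For j < b the vertex below the target then
  -- carries the extra 2, so it is not a predecessor.
  · by_cases h1 : b % 2 = 0 ∨ (a + 2 = m ∧ j < b)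
    · refine right (by omega) ?_
      rw [hcol, hleft]
      split_ifs <;> first | contradiction | omega
    · refine up (by omega) (by omega) ?_
      rw [hcol, hcol]
      split_ifs <;> first | contradiction | omega
  · by_cases h1 : (a + 1 = m → b % 2 = 1) ∧ (a = 1 → b % 2 = 0)
    · refine right (by omega) ?_
      rw [hcol, hleft]
      split_ifs <;> first | contradiction | omega
    · by_cases h2 : a = 1
      · refine up (by omega) (by omega) ?_
        rw [hcol, hcol]
        split_ifs <;> first | contradiction | omega
      · refine down (a - 1) (by omega) (by omega) ?_
        rw [hcol, hcol]
        split_ifs <;> first | contradiction | omega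
  -- Mirror image, with the source in row 1.
  · by_cases h1 : b % 2 = 1 ∨ (a = 2 ∧ j < b)
    · refine right (by omega) ?_
      rw [hcol, hleft]
      split_ifs <;> first | contradiction | omega
    · refine down (a - 1) (by omega) (by omega) ?_
      rw [hcol, hcol]
      split_ifs <;> first | contradiction | omega

lemma exists_combPred {m n i j a b : ℕ} (hm : 4 ≤ m) (hn : n % 2 = 0) (hi : i < m) (hj : j < n)
    (ha : a < m) (hb : b < n) (hne : ¬ (a = i ∧ b = j)) :
    ∃ x y, CombPred m n i j a b x y := by
  by_cases h0 : i = 0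
  · subst h0
    exact exists_combPred_of_zero hm hn hj ha hb hne
  rcases lt_trichotomy b j with h | rfl | h
  · exact exists_combPred_of_lt hm h0 hi hj ha h
  · exact exists_combPred_of_eq hm hn h0 hi hj ha (by omega)
  · obtain ⟨c, rfl⟩ : ∃ c, b = c + 1 := ⟨b - 1, by omega⟩
    exact exists_combPred_of_gt hm hn h0 hi ha hb h

lemma CombArc.combDist_le {m n i j a b a' b' : ℕ} (hm : 4 ≤ m) (hn : n % 2 = 0) (hi : i < m)
    (hj : j < n) (ha : a < m) (hb : b < n) (ha' : a' < m) (hb' : b' < n)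
    (h : CombArc m n a b a' b') :
    combDist m n i j a' b' ≤ combDist m n i j a b + 1 := by
  rcases h with ⟨rfl, rfl, h⟩ | ⟨rfl, rfl, h⟩ | ⟨rfl, rfl, h⟩ | ⟨rfl, rfl, h⟩
  · exact combDist_right hm hn hi hj ha hb' h
  · exact combDist_left hm hn hi hj hb (by omega)
  · exact combDist_down hm hn hi hj ha' hb h
  · exact combDist_up hm hn hi hj ha hb h

/-! ### The formula is the distance -/

lemma HasPathOfLength.trans_adj {V : Type*} {D : Digraph V} {u x v : V} {t : ℕ}
    (h : HasPathOfLength D u x t) (hxv : D.Adj x v) : HasPathOfLength D u v (t + 1) := by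
  obtain ⟨p, h0, ht, hp⟩ := h
  refine ⟨fun k => if k ≤ t then p k else v, by simpa using h0, by simp, fun k hk => ?_⟩
  rcases Nat.lt_succ_iff_lt_or_eq.mp hk with h | rfl
  · simpa [h.le, Nat.succ_le_of_lt h] using hp k h
  · simpa [ht] using hxv

theorem dist_comb {m n : ℕ} (hm : 4 ≤ m) (hn : Even n) (u v : Fin m × Fin n) :
    (dist (comb m n) u v : ℤ) = combDist m n u.1 u.2 v.1 v.2 := by
  have hn2 := Nat.even_iff.mp hn
  have hpath : ∀ k : ℕ, ∀ w : Fin m × Fin n, combDist m n u.1 u.2 w.1 w.2 = k →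
      HasPathOfLength (comb m n) u w k := by
    intro k
    induction k with
    | zero =>
      intro w hw
      by_cases hne : (w.1 : ℕ) = u.1 ∧ (w.2 : ℕ) = u.2
      · have : w = u := Prod.ext (Fin.ext hne.1) (Fin.ext hne.2)
        exact ⟨fun _ => u, rfl, this.symm, by simp⟩
      -- A predecessor would have value -1.
      · obtain ⟨x, y, hx, hy, -, hd⟩ :=
          exists_combPred hm hn2 u.1.2 u.2.2 w.1.2 w.2.2 hne
        have := combDist_nonneg hm u.1.2 u.2.2 hx hy
        omega
    | succ k ih =>
      intro w hw
      by_cases hne : (w.1 : ℕ) = u.1 ∧ (w.2 : ℕ) = u.2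
      · rw [hne.1, hne.2, combDist_self] at hw
        omega
      · obtain ⟨x, y, hx, hy, harc, hd⟩ :=
          exists_combPred hm hn2 u.1.2 u.2.2 w.1.2 w.2.2 hne
        exact (ih (⟨x, hx⟩, ⟨y, hy⟩) (by simp only; omega)).trans_adj
          ((comb_adj_iff hm hn _ _).mpr harc)
  obtain ⟨k, hk⟩ := Int.eq_ofNat_of_zero_le (combDist_nonneg hm u.1.2 u.2.2 v.1.2 v.2.2)
  have hk' := hpath k v hk
  rw [hk]
  norm_cast
  -- A path exists, so the default value 0 of the infimum plays no role.
  refine le_antisymm (Nat.sInf_le hk') (le_csInf ⟨k, hk'⟩ ?_)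
  rintro t ⟨p, h0, ht, hp⟩
  have hle : ∀ s ≤ t, combDist m n u.1 u.2 (p s).1 (p s).2 ≤ s := by
    intro s
    induction s with
    | zero => intro _; rw [h0, combDist_self]; simp
    | succ s ih =>
      intro hs
      have h1 := ih (by omega)
      have h2 := ((comb_adj_iff hm hn _ _).mp (hp s (by omega))).combDist_le hm hn2 u.1.2 u.2.2
        (p s).1.2 (p s).2.2 (p (s + 1)).1.2 (p (s + 1)).2.2
      push_cast
      omega
  have := hle t le_rfl
  rw [ht, hk] at this
  exact_mod_cast this

/-! ### Elementary sums -/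

open Finset

lemma sum_square_succ (f : ℕ → ℕ → ℚ) (M : ℕ) :
    ∑ i ∈ range (M + 1), ∑ a ∈ range (M + 1), f i a =
      f 0 0 + ∑ a ∈ range M, f 0 (a + 1) + ∑ i ∈ range M, f (i + 1) 0 +
        ∑ i ∈ range M, ∑ a ∈ range M, f (i + 1) (a + 1) := by
  simp only [sum_range_succ', sum_add_distrib]
  ring

/-- Adding each term to its mirror image removes the case distinction between forward and backward
pairs. -/
lemma sum_square_eq (f : ℕ → ℕ → ℚ) (M : ℕ) :
    ∑ i ∈ range M, ∑ a ∈ range M, f i a =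
      ∑ i ∈ range M, f i i + ∑ i ∈ range M, ∑ a ∈ range i, (f i a + f a i) := by
  induction M with
  | zero => simp
  | succ M ih =>
    rw [sum_range_succ (fun i => f i i), sum_range_succ (fun i => ∑ a ∈ range i, (f i a + f a i))]
    simp only [sum_range_succ, sum_add_distrib] at ih ⊢
    linarith

lemma sum_nat (M : ℕ) : ∑ a ∈ range M, (a : ℚ) = M * (M - 1) / 2 := by
  induction M with
  | zero => simp
  | succ M ih => rw [sum_range_succ, ih]; push_cast; ring

lemma sum_nat_sq (M : ℕ) : ∑ a ∈ range M, (a : ℚ) ^ 2 = M * (M - 1) * (2 * M - 1) / 6 := by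
  induction M with
  | zero => simp
  | succ M ih => rw [sum_range_succ, ih]; push_cast; ring

lemma sum_parity (n : ℕ) (hn : n % 2 = 0) (x y : ℚ) :
    ∑ j ∈ range n, (if j % 2 = 1 then x else y) = n / 2 * (x + y) := by
  obtain ⟨k, rfl⟩ : ∃ k, n = 2 * k := ⟨n / 2, by omega⟩
  induction k with
  | zero => simp
  | succ k ih =>
    rw [show 2 * (k + 1) = 2 * k + 1 + 1 by ring, sum_range_succ, sum_range_succ, ih (by omega),
      if_neg (by omega), if_pos (by omega)]
    push_cast
    ring

lemma sum_triangle_even (n : ℕ) (hn : n % 2 = 0) (x : ℚ) :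
    ∑ j ∈ range n, ∑ b ∈ range j, (if b % 2 = 1 then 0 else x) = n ^ 2 / 4 * x := by
  obtain ⟨k, rfl⟩ : ∃ k, n = 2 * k := ⟨n / 2, by omega⟩
  induction k with
  | zero => simp
  | succ k ih =>
    rw [show 2 * (k + 1) = 2 * k + 1 + 1 by ring, sum_range_succ, sum_range_succ, ih (by omega),
      sum_range_succ, sum_parity _ (by omega), if_neg (by omega)]
    push_cast
    ring

lemma sum_triangle_succ_eq (n : ℕ) (hn : 1 ≤ n) (x : ℚ) :
    ∑ j ∈ range n, ∑ b ∈ range j, (if j = b + 1 then x else 0) = (n - 1) * x := by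
  obtain ⟨k, rfl⟩ : ∃ k, n = k + 1 := ⟨n - 1, by omega⟩
  rw [sum_range_succ']
  simp [Finset.sum_ite_eq]

/-- The sum of the detour lengths over all pairs of vertices in an inner column of an even grid. -/
lemma sum_triangle_detour (M : ℕ) (h : M % 2 = 1) :
    ∑ i ∈ range M, ∑ a ∈ range i,
      (if i + a + 1 ≤ M then (i : ℚ) + a + 2 else 2 * M - i - a) =
      ((M : ℚ) + 1) ^ 3 / 3 - 3 * (M + 1) ^ 2 / 4 + (M + 1) / 6 := by
  obtain ⟨k, rfl⟩ : ∃ k, M = 2 * k + 1 := ⟨M / 2, by omega⟩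
  clear h
  induction k with
  | zero => norm_num
  | succ k ih =>
    -- Shifting both indices by one preserves the threshold and adds 2 to either branch, so the old
    -- triangle reappears inside the new one.
    rw [show 2 * (k + 1) + 1 = 2 * k + 1 + 2 by ring]
    generalize 2 * k + 1 = N at ih ⊢
    have hrow : ∀ i < N, ∑ a ∈ range (i + 1), (if i + 1 + a + 1 ≤ N + 2 then
        ((i + 1 : ℕ) : ℚ) + a + 2 else 2 * ((N + 2 : ℕ) : ℚ) - (i + 1 : ℕ) - a) =
        ∑ a ∈ range i, (if i + a + 1 ≤ N then (i : ℚ) + a + 2 else 2 * N - i - a) + 3 * i + 3 := by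
      intro i hi
      rw [sum_range_succ', if_pos (by omega)]
      have : ∀ a ∈ range i, (if i + 1 + (a + 1) + 1 ≤ N + 2 then
          ((i + 1 : ℕ) : ℚ) + (a + 1 : ℕ) + 2
          else 2 * ((N + 2 : ℕ) : ℚ) - (i + 1 : ℕ) - (a + 1 : ℕ)) =
          (if i + a + 1 ≤ N then (i : ℚ) + a + 2 else 2 * N - i - a) + 2 := by
        intro a _
        by_cases h : i + a + 1 ≤ N
        · rw [if_pos h, if_pos (by omega)]; push_cast; ring
        · rw [if_neg h, if_neg (by omega)]; push_cast; ring
      rw [sum_congr rfl this, sum_add_distrib]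
      simp
      ring
    have hlast : ∑ a ∈ range (N + 1), (if N + 1 + a + 1 ≤ N + 2 then
        ((N + 1 : ℕ) : ℚ) + a + 2 else 2 * ((N + 2 : ℕ) : ℚ) - (N + 1 : ℕ) - a) =
        (N : ℚ) + 3 + ∑ a ∈ range N, ((N : ℚ) + 2 - a) := by
      rw [sum_range_succ', if_pos (by omega), add_comm]
      congr 1
      · push_cast; ring
      · refine sum_congr rfl fun a _ => ?_
        rw [if_neg (by omega)]; push_cast; ring
    rw [show N + 2 = N + 1 + 1 by ring, sum_range_succ, sum_range_succ']
    rw [show N + 1 + 1 = N + 2 by ring, sum_congr rfl fun i hi => hrow i (mem_range.mp hi), hlast]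
    simp only [sum_add_distrib, sum_sub_distrib, ← mul_sum, sum_nat, ih]
    simp
    ring

lemma sum_triangle_sub (M : ℕ) :
    ∑ i ∈ range M, ∑ a ∈ range i, ((i : ℚ) - a) = (M ^ 3 - M) / 6 := by
  induction M with
  | zero => simp
  | succ M ih =>
    rw [sum_range_succ, ih, sum_sub_distrib, sum_nat]; simp; ring

/-! ### Distance sums between two columns -/

/-- The sum of the distances from column `j` to column `b`. -/
def columnSum (m n j b : ℕ) : ℚ :=
  ∑ i ∈ range m, ∑ a ∈ range m, (combDist m n i j a b : ℚ)

/-- Traversing a column up or down uses the same set of positions, so parity drops out. -/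
lemma sum_lowPos (M n b : ℕ) : ∑ a ∈ range M, (lowPos (M + 1) n (a + 1) b : ℚ) =
    M * (n + (n - 1 - b) * M) + M * (M - 1) / 2 := by
  simp only [lowPos, colOffset]
  by_cases h : b % 2 = 1
  · simp [h, sum_add_distrib, sum_nat]
    ring
  · simp [h, sum_add_distrib, sum_nat]
    ring

lemma lowPos_one (M n b : ℕ) : (lowPos (M + 1) n 1 b : ℚ) =
    n + (n - 1 - b) * M + if b % 2 = 1 then 0 else (M - 1 : ℚ) := by
  simp only [lowPos, colOffset]
  split_ifs <;> push_cast <;> ring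

lemma columnSum_left {M n j b : ℕ} (h : b < j) :
    columnSum (M + 1) n j b = (n + (n - 1 - b) * M + 1 - j) +
      (M * (n + (n - 1 - b) * M - j) + M * (M - 1) / 2) +
      (M * ((j - b) * M + 1) - M * (M - 1) / 2) + M ^ 3 * (j - b) +
      (M + 1) * if b % 2 = 1 then 0 else (M - 1 : ℚ) := by
  have h1 : ∀ a, combDist (M + 1) n 0 j (a + 1) b = lowPos (M + 1) n (a + 1) b - j := fun a => by
    simp [combDist]
  have h2 : ∀ i, combDist (M + 1) n (i + 1) j 0 b =
      lowPos (M + 1) n 1 b + 1 - lowPos (M + 1) n (i + 1) j := fun i => by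
    simp [combDist, h]
  have h3 : ∀ i a, combDist (M + 1) n (i + 1) j (a + 1) b =
      lowPos (M + 1) n (a + 1) b - lowPos (M + 1) n (i + 1) j := fun i a => by
    simp [combDist, h]
  have h0 : combDist (M + 1) n 0 j 0 b = lowPos (M + 1) n 1 b + 1 - j := by
    simp [combDist, h]
  rw [columnSum, sum_square_succ]
  simp only [h0, h1, h2, h3]
  push_cast
  simp only [sum_sub_distrib, sum_add_distrib, sum_lowPos, sum_const, card_range, nsmul_eq_mul,
    lowPos_one, ← mul_sum]
  ring

/-- The 4 counts the extra 2 in row 1 and in the bottom row; between adjacent columns only one of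
these rows is blocked. -/
lemma columnSum_right {M n j b : ℕ} (hM : 3 ≤ M) (h : j < b) :
    columnSum (M + 1) n j b = (b - j) +
      (M * (n + (n - 1 - b) * M - j) + M * (M - 1) / 2) +
      (M * (b - j) + M * (M + 1) / 2) + M ^ 2 * (b - j) + (M ^ 3 - M) / 3 + 4 -
      if b = j + 1 then 2 else 0 := by
  have h1 : ∀ a, combDist (M + 1) n 0 j (a + 1) b = lowPos (M + 1) n (a + 1) b - j := fun a => by
    simp [combDist]
  have h2 : ∀ i, combDist (M + 1) n (i + 1) j 0 b = b - j + (i + 1) := fun i => by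
    simp [combDist, h.not_gt, h.ne']
  have h3 : ∀ i, ∀ a ∈ range i, (combDist (M + 1) n (i + 1) j (a + 1) b : ℚ) +
      combDist (M + 1) n (a + 1) j (i + 1) b = 2 * ((b : ℚ) - j) + 2 * (i - a) := fun i a ha => by
    have := mem_range.mp ha
    simp [combDist, h.not_gt, h.ne', this, this.not_gt]
    ring
  have h4 : ∀ i, (combDist (M + 1) n (i + 1) j (i + 1) b : ℚ) = b - j +
      (if i = M - 1 then (if j % 2 = 0 ∨ j + 2 ≤ b then 2 else 0) else 0) +
      (if i = 0 then (if j % 2 = 1 ∨ j + 2 ≤ b then 2 else 0) else 0) := fun i => by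
    have : i = M - 1 ↔ i + 1 = M := by omega
    simp [combDist, h.not_gt, h.ne', this, ite_and]
  have h0 : combDist (M + 1) n 0 j 0 b = b - j := by
    simp [combDist, h.le]
  have h5 : ∑ i ∈ range M, ∑ a ∈ range i, (2 * ((b : ℚ) - j) + 2 * ((i : ℚ) - a)) =
      M * (M - 1) * (b - j) + (M ^ 3 - M) / 3 := by
    simp only [sum_add_distrib, ← mul_sum, sum_triangle_sub, sum_const, card_range, nsmul_eq_mul]
    rw [← sum_mul, sum_nat]
    ring
  rw [columnSum, sum_square_succ, sum_square_eq]
  simp only [h0, h1, h2, h4]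
  rw [sum_congr rfl fun i _ => sum_congr rfl (h3 i), h5]
  have hA : M - 1 ∈ range M := mem_range.mpr (by omega)
  have hB : 0 ∈ range M := mem_range.mpr (by omega)
  push_cast
  simp only [sum_sub_distrib, sum_add_distrib, sum_lowPos, sum_const, card_range, nsmul_eq_mul,
    sum_ite_eq', hA, hB, if_true, sum_nat, mul_one]
  have hc : ((if j % 2 = 0 ∨ j + 2 ≤ b then 2 else 0 : ℚ)) +
      (if j % 2 = 1 ∨ j + 2 ≤ b then 2 else 0) = 4 - if b = j + 1 then 2 else 0 := by
    by_cases hb : b = j + 1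
    · rcases Nat.mod_two_eq_zero_or_one j with h | h <;> simp [hb, h] <;> norm_num
    · simp [hb, show j + 2 ≤ b by omega]; norm_num
  linarith

/-- The cubic bracket is the detour total of an inner column. The first and last columns have one
neighbour, so their detour total is replaced; the last also has longer ways to its top vertex. -/
lemma columnSum_self {M n j : ℕ} (hM : 3 ≤ M) (hM2 : M % 2 = 1) (hn : n % 2 = 0) (hj : j < n) :
    columnSum (M + 1) n j j =
      (M * (n + (n - 1 - j) * M - j) + M * (M - 1) / 2) + M * (M + 1) / 2 +
      (M ^ 3 - M) / 6 + (((M : ℚ) + 1) ^ 3 / 3 - 3 * (M + 1) ^ 2 / 4 + (M + 1) / 6) +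
      (if j % 2 = 1 then 2 * (M : ℚ) - 2 else 0) +
      (if j = 0 then (M ^ 3 - M) / 2 -
        (((M : ℚ) + 1) ^ 3 / 3 - 3 * (M + 1) ^ 2 / 4 + (M + 1) / 6) else 0) +
      (if j = n - 1 then (M ^ 3 - M) / 2 -
        (((M : ℚ) + 1) ^ 3 / 3 - 3 * (M + 1) ^ 2 / 4 + (M + 1) / 6) +
        (2 * (M + 1) * M - M * (M + 1) - 2 * M + 2) else 0) := by
  have h1 : ∀ a, combDist (M + 1) n 0 j (a + 1) j = lowPos (M + 1) n (a + 1) j - j := fun a => by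
    simp [combDist]
  have h0 : combDist (M + 1) n 0 j 0 j = 0 := by simp [combDist]
  have h2 : ∑ i ∈ range M, (combDist (M + 1) n (i + 1) j 0 j : ℚ) = M * (M + 1) / 2 +
      (if j % 2 = 1 then 2 * (M : ℚ) - 2 else 0) +
      (if j = n - 1 then 2 * ((M : ℚ) + 1) * M - M * (M + 1) - 2 * M + 2 else 0) := by
    by_cases hj2 : j % 2 = 1
    · by_cases hl : j = n - 1
      · have : ∀ i, combDist (M + 1) n (i + 1) j 0 j = 2 * (M + 1) - (i + 1) := fun i => by
          simp [combDist, hj2, show j + 1 = n by omega]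
        rw [if_pos hj2, if_pos hl]
        simp only [this]
        push_cast
        simp only [sum_sub_distrib, sum_add_distrib, sum_const, card_range, nsmul_eq_mul, sum_nat]
        ring
      · have : ∀ i, (combDist (M + 1) n (i + 1) j 0 j : ℚ) =
            (i + 3) - if i = 0 then 2 else 0 := fun i => by
          rcases Nat.eq_zero_or_pos i with rfl | hi
          · simp [combDist, hj2, show j + 1 ≠ n by omega]; norm_num
          · simp [combDist, hj2, show j + 1 ≠ n by omega, hi.ne']; ring
        rw [if_pos hj2, if_neg hl]
        simp only [this]
        simp only [sum_sub_distrib, sum_add_distrib, sum_const, card_range, nsmul_eq_mul, sum_nat,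
          sum_ite_eq', mem_range, show 0 < M by omega, if_true]
        ring
    · have : ∀ i, combDist (M + 1) n (i + 1) j 0 j = i + 1 := fun i => by
        simp [combDist, show j % 2 = 0 by omega]
      rw [if_neg hj2, if_neg (show j ≠ n - 1 by omega)]
      simp only [this]
      push_cast
      simp only [sum_add_distrib, sum_const, card_range, nsmul_eq_mul, sum_nat]
      ring
  have hdiag : ∀ i, combDist (M + 1) n (i + 1) j (i + 1) j = 0 := fun i => combDist_self _ _ _ _
  have h3 : ∑ i ∈ range M, ∑ a ∈ range i, ((combDist (M + 1) n (i + 1) j (a + 1) j : ℚ) +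
      combDist (M + 1) n (a + 1) j (i + 1) j) = (M ^ 3 - M) / 6 +
      if j = 0 ∨ j = n - 1 then ((M : ℚ) ^ 3 - M) / 2 else
        ((M : ℚ) + 1) ^ 3 / 3 - 3 * (M + 1) ^ 2 / 4 + (M + 1) / 6 := by
    by_cases he : j = 0 ∨ j = n - 1
    · have : ∀ i, ∀ a ∈ range i, (combDist (M + 1) n (i + 1) j (a + 1) j : ℚ) +
          combDist (M + 1) n (a + 1) j (i + 1) j = (i - a) + (2 * M - i - a) := fun i a ha => by
        have := mem_range.mp ha
        rcases he with rfl | he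
        · simp [combDist, this.le, this.not_ge]; ring
        · simp [combDist, this.le, this.not_ge, show j + 1 = n by omega, show j % 2 = 1 by omega]
          ring
      rw [sum_congr rfl fun i _ => sum_congr rfl (this i), if_pos he]
      simp only [sum_sub_distrib, sum_add_distrib, sum_const, card_range, nsmul_eq_mul, sum_nat]
      have e : ∀ i : ℕ, (i : ℚ) * (i - 1) / 2 = i ^ 2 / 2 - i / 2 := fun i => by ring
      simp only [e, sum_sub_distrib, ← sum_div, ← sum_mul, ← sq, sum_nat, sum_nat_sq]
      ring
    · have : ∀ i, ∀ a ∈ range i, (combDist (M + 1) n (i + 1) j (a + 1) j : ℚ) +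
          combDist (M + 1) n (a + 1) j (i + 1) j = (i - a) +
          (if i + a + 1 ≤ M then (i : ℚ) + a + 2 else 2 * M - i - a) := fun i a ha => by
        have := mem_range.mp ha
        have c1 : i + 1 + (a + 1) ≤ M + 1 ↔ i + a + 1 ≤ M := by omega
        have c2 : a + 1 + (i + 1) ≤ M + 1 ↔ i + a + 1 ≤ M := by omega
        by_cases hc : i + a + 1 ≤ M
        · rcases Nat.mod_two_eq_zero_or_one j with h | h
          · simp [combDist, this.le, this.not_ge, show j ≠ 0 by omega, h, c2, hc]; ring
          · simp [combDist, this.le, this.not_ge, show j + 1 ≠ n by omega, h, c1, hc]; ring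
        · rcases Nat.mod_two_eq_zero_or_one j with h | h
          · simp [combDist, this.le, this.not_ge, show j ≠ 0 by omega, h, c2, hc]; ring
          · simp [combDist, this.le, this.not_ge, show j + 1 ≠ n by omega, h, c1, hc]; ring
      rw [sum_congr rfl fun i _ => sum_congr rfl (this i), if_neg he]
      simp only [sum_add_distrib]
      rw [sum_triangle_sub, sum_triangle_detour M hM2]
  rw [columnSum, sum_square_succ, sum_square_eq, h2, h3]
  simp only [h0, h1, hdiag]
  push_cast
  simp only [sum_sub_distrib, sum_lowPos, sum_const, card_range, nsmul_eq_mul]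
  by_cases e1 : j = 0
  · simp [e1, show (0 : ℕ) ≠ n - 1 by omega]; ring
  · by_cases e2 : j = n - 1
    · simp [← e2, e1]; ring
    · simp [e1, e2]; ring

/-! ### The Wiener index as a polynomial -/

lemma wienerIndex_comb_eq_sum {m n : ℕ} (hm : 4 ≤ m) (hn : Even n) :
    (wienerIndex (comb m n) : ℚ) = ∑ j ∈ range n, ∑ b ∈ range n, columnSum m n j b := by
  have h : ∀ u v, (dist (comb m n) u v : ℚ) = combDist m n u.1 u.2 v.1 v.2 := fun u v => by
    rw [← dist_comb hm hn]; simp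
  unfold wienerIndex columnSum
  push_cast
  simp only [h, Fintype.sum_prod_type]
  have h2 : ∀ i j, ∑ a : Fin m, ∑ b : Fin n, (combDist m n i j a b : ℚ) =
      ∑ b ∈ range n, ∑ a ∈ range m, (combDist m n i j a b : ℚ) := fun i j => by
    rw [sum_comm, ← Fin.sum_univ_eq_sum_range]
    exact sum_congr rfl fun b _ =>
      Fin.sum_univ_eq_sum_range (fun a => (combDist m n i j a b : ℚ)) m
  simp only [h2]
  rw [sum_comm, ← Fin.sum_univ_eq_sum_range]
  refine sum_congr rfl fun j _ => ?_
  rw [sum_comm]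
  refine sum_congr rfl fun b _ => ?_
  exact Fin.sum_univ_eq_sum_range (fun i => ∑ a ∈ range m, (combDist m n i j a b : ℚ)) m

lemma sum_triangle_fst (n : ℕ) :
    ∑ j ∈ range n, ∑ _b ∈ range j, (j : ℚ) = n * (n - 1) * (2 * n - 1) / 6 := by
  simp only [sum_const, card_range, nsmul_eq_mul, ← sq, sum_nat_sq]

lemma sum_triangle_snd (n : ℕ) :
    ∑ j ∈ range n, ∑ b ∈ range j, (b : ℚ) = n * (n - 1) * (n - 2) / 6 := by
  have h : ∀ j : ℕ, (j : ℚ) * (j - 1) / 2 = j ^ 2 / 2 - j / 2 := fun j => by ring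
  simp only [sum_nat, h, sum_sub_distrib, ← sum_div, sum_nat_sq]
  ring

lemma sum_triangle_const (n : ℕ) (x : ℚ) :
    ∑ j ∈ range n, ∑ _b ∈ range j, x = n * (n - 1) / 2 * x := by
  simp only [sum_const, card_range, nsmul_eq_mul, ← sum_mul, sum_nat]

lemma sum_triangle_affine (n : ℕ) (hn : n % 2 = 0) (hn1 : 1 ≤ n) (x y z w : ℚ) :
    ∑ j ∈ range n, ∑ b ∈ range j, (x + y * j - z * b + (if b % 2 = 1 then 0 else w) -
      if j = b + 1 then 2 else 0) = n * (n - 1) / 2 * x + y * (n * (n - 1) * (2 * n - 1) / 6) -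
      z * (n * (n - 1) * (n - 2) / 6) + n ^ 2 / 4 * w - (n - 1) * 2 := by
  simp only [sum_sub_distrib, sum_add_distrib, ← mul_sum]
  rw [sum_triangle_const, sum_triangle_fst, sum_triangle_snd, sum_triangle_even n hn,
    sum_triangle_succ_eq n hn1]

theorem wienerIndex_comb {m n : ℕ} (hm : 4 ≤ m) (hm2 : Even m) (hn : Even n) (hn2 : 2 ≤ n) :
    (wienerIndex (comb m n) : ℚ) = (m : ℚ) ^ 3 * n ^ 3 / 6 + m ^ 3 * n ^ 2 / 6 + m ^ 3 * n / 6 +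
      m ^ 3 / 3 + m ^ 2 * n ^ 3 / 3 - m ^ 2 * n ^ 2 / 4 - m ^ 2 * n / 12 - m ^ 2 / 2 -
      m * n ^ 3 / 6 + m * n ^ 2 / 3 - m * n / 6 - 4 * m / 3 + 2 * n ^ 2 - 6 * n + 6 := by
  have h1 := Nat.even_iff.mp hm2
  have h2 := Nat.even_iff.mp hn
  rw [wienerIndex_comb_eq_sum hm hn, sum_square_eq]
  obtain ⟨M, rfl⟩ : ∃ M, m = M + 1 := ⟨m - 1, by omega⟩
  rw [sum_congr rfl fun j hj => columnSum_self (by omega) (by omega) h2 (mem_range.mp hj)]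
  -- Both directions together are affine in j and b, up to the parity and adjacency corrections.
  have hpair : ∀ j, ∀ b ∈ range j, columnSum (M + 1) n j b + columnSum (M + 1) n b j =
      (((M : ℚ) + 1) * (2 * n + 2 * (n - 1) * M) + 1 - n - (n - 1) * M + M + M ^ 2 +
        (M ^ 3 - M) / 3 + 4) + ((M : ℚ) ^ 3 + M ^ 2) * j -
      ((M : ℚ) ^ 3 + 3 * M ^ 2 + 3 * M + 1) * b +
      (if b % 2 = 1 then 0 else ((M : ℚ) + 1) * (M - 1)) - if j = b + 1 then 2 else 0 := by
    intro j b hb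
    rw [columnSum_left (mem_range.mp hb), columnSum_right (by omega) (mem_range.mp hb)]
    split_ifs <;> ring
  rw [sum_congr rfl fun j _ => sum_congr rfl (hpair j),
    sum_triangle_affine n h2 (by omega)]
  have hdiag : ∀ j : ℕ, ((M : ℚ) * (n + (n - 1 - j) * M - j) + M * (M - 1) / 2) =
      (M * (n + (n - 1) * M) + M * (M - 1) / 2) - (M * (M + 1)) * j := fun j => by ring
  simp only [hdiag, sum_add_distrib, sum_sub_distrib, ← mul_sum,
    sum_parity n h2, sum_nat, sum_ite_eq', mem_range, show 0 < n by omega,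
    show n - 1 < n by omega, if_true, sum_const, card_range, nsmul_eq_mul]
  push_cast
  ring

end DirectedGrid

/-! ### Comparison of the two orientations -/

theorem theorem4 (m n : ℕ) (hm : Even m) (hn : Even n) (h4 : 4 ≤ m) (hmn : m < n) :
    DirectedGrid.wienerIndex (DirectedGrid.comb n m) <
      DirectedGrid.wienerIndex (DirectedGrid.comb m n) := by
  have h1 := DirectedGrid.wienerIndex_comb h4 hm hn (by omega)
  have h2 := DirectedGrid.wienerIndex_comb (show 4 ≤ n by omega) hn hm (by omega)
  -- In the slack variables s, t ≥ 0 the difference has only positive coefficients.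
  obtain ⟨s, rfl⟩ : ∃ s, m = 4 + s := ⟨m - 4, by omega⟩
  obtain ⟨t, rfl⟩ : ∃ t, n = 4 + s + (t + 1) := ⟨n - (4 + s) - 1, by omega⟩
  rw [← Nat.cast_lt (α := ℚ), h1, h2, ← sub_pos]
  push_cast
  ring_nf
  positivity
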